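/- Throughout, $B_r$ denotes the closed Euclidean ball of radius $r$ centred at $0$, linear maps carry the operator norm $|\cdot|$, a convex cone is a non-empty convex set $\Gamma$ with $\alpha k\in\Gamma$ for all $\alpha\ge 0$, $k\in\Gamma$, and for a set-valued map $F$ we write $F(A)=\bigcup_{\gamma\in A}F(\gamma)$. A modulus is a nondecreasing function $\rho:[0,\infty)\to[0,\infty)$ with $\rho(0)=0=\lim_{s\to0^+}\rho(s)$. Definition (QDQ). Let $F:\mathbb R^N\rightsquigarrow\mathbb R^n$ be a set-valued map, $(\bar\gamma,\bar y)\in\mathbb R^N\times\mathbb R^n$, $\Gamma\subset\mathbb R^N$ any set, and $\Lambda\subset \mathrm{Lin}(\mathbb R^N,\mathbb R^n)$ a compact set. For a modulus $\rho$ and $\delta>0$, call a pair of continuous maps $(L_\delta,h_\delta):\bar\gamma+(B_\delta\cap\Gamma)\to \mathrm{Lin}(\mathbb R^N,\mathbb R^n)\times\mathbb R^n$ *admissible for $(\rho,\delta)$* if for all $\gamma\in\bar\gamma+(B_\delta\cap\Gamma)$ $$\min_{L'\in\Lambda}|L_\delta(\gamma)-L'|\le\rho(\delta),\qquad |h_\delta(\gamma)|\le\delta\rho(\delta),\qquad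 \bar y+L_\delta(\gamma)\cdot(\gamma-\bar\gamma)+h_\delta(\gamma)\in F(\gamma).$$ $\Lambda$ is a Quasi Differential Quotient (QDQ) of $F$ at $(\bar\gamma,\bar y)$ in the direction of $\Gamma$ if there is a modulus $\rho$ such that for every $\delta>0$ a pair admissible for $(\rho,\delta)$ exists; such a $\rho$ is said to witness the QDQ. Theorem (Open Mapping). Let $N,n$ be positive integers, let $\Gamma\subset\mathbb R^N$ be a convex cone, let $F:\mathbb R^N\rightsquigarrow\mathbb R^n$ be a set-valued map, and let $\Lambda$ be a QDQ of $F$ at $(\bar\gamma,\bar y)$ in the direction of $\Gamma$. Assume that $\Lambda$ is surjective, i.e. $L\cdot\Gamma=\mathbb R^n$ for every $L\in\Lambda$. Then: (i) there are constants $\alpha,\beta>0$ such that $$\bar y+\big(B_a\setminus\{0\}\big)\subset F\big(\bar\gamma+(B_{a\beta}\cap\Gamma)\big)\qquad\text{for all } a\in(0,\alpha];$$ (ii) for every modulus $\rho$ witnessing the QDQ there exists $\check\delta>0$ such that, for every $\delta\in(0,\check\delta]$ and every pair $(L_\delta,h_\delta)$ admissible for $(\rho,\delta)$, there exists $\gamma_\delta\in\bar\gamma+(\Gamma\cap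 B_\delta)$ with $$\bar y=\bar y+L_\delta(\gamma_\delta)\cdot(\gamma_\delta-\bar\gamma)+h_\delta(\gamma_\delta)\in F(\gamma_\delta).$$ In particular, for any $\alpha,\beta>0$ as in (i) there is $\alpha'\in(0,\alpha]$ such that the non-punctured open-mapping inclusions $$\bar y+B_a\subset F\big(\bar\gamma+(B_{a\beta}\cap\Gamma)\big)\qquad\text{for all } a\in(0,\alpha']$$ hold. -/

import Mathlib

open Filter Topology

/-- A modulus: a nondecreasing function `ρ : [0, ∞) → [0, ∞)` with `ρ 0 = 0` and
`ρ s → 0` as `s → 0⁺`. (Only the values of `ρ` on `[0, ∞)` matter.) -/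
structure IsModulus (ρ : ℝ → ℝ) : Prop where
  nonneg : ∀ s, 0 ≤ s → 0 ≤ ρ s
  mono : MonotoneOn ρ (Set.Ici 0)
  zero : ρ 0 = 0
  tendsto : Tendsto ρ (𝓝[>] 0) (𝓝 0)

/-- The set `p + (Γ ∩ B_δ)`, where `B_δ` is the closed ball of radius `δ` centred at `0`. -/
def truncAt {E : Type*} [NormedAddCommGroup E] (p : E) (Γ : Set E) (δ : ℝ) : Set E :=
  (fun v => p + v) '' (Γ ∩ Metric.closedBall 0 δ)

/-- The image `F(A) = ⋃_{γ ∈ A} F(γ)` of a set under a set-valued map. -/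
def setImage {X Y : Type*} (F : X → Set Y) (A : Set X) : Set Y :=
  ⋃ γ ∈ A, F γ

/-- `(L, h)` is a pair `(L_δ, h_δ)` as in the definition of a QDQ, for the radius `δ` and the
bound `r = ρ(δ)`: it is continuous on `p + (Γ ∩ B_δ)` and, on that set,
`min_{L' ∈ Λ} |L(γ) - L'| ≤ r`, `|h(γ)| ≤ δ r` and `q + L(γ)·(γ - p) + h(γ) ∈ F(γ)`. -/
structure IsQDQPair {N n : ℕ}
    (F : EuclideanSpace ℝ (Fin N) → Set (EuclideanSpace ℝ (Fin n)))
    (p : EuclideanSpace ℝ (Fin N)) (q : EuclideanSpace ℝ (Fin n))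
    (Λ : Set (EuclideanSpace ℝ (Fin N) →L[ℝ] EuclideanSpace ℝ (Fin n)))
    (Γ : Set (EuclideanSpace ℝ (Fin N))) (δ r : ℝ)
    (L : EuclideanSpace ℝ (Fin N) →
      (EuclideanSpace ℝ (Fin N) →L[ℝ] EuclideanSpace ℝ (Fin n)))
    (h : EuclideanSpace ℝ (Fin N) → EuclideanSpace ℝ (Fin n)) : Prop where
  continuousOn_L : ContinuousOn L (truncAt p Γ δ)
  continuousOn_h : ContinuousOn h (truncAt p Γ δ)
  near : ∀ γ ∈ truncAt p Γ δ, ∃ L' ∈ Λ, ‖L γ - L'‖ ≤ r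
  small : ∀ γ ∈ truncAt p Γ δ, ‖h γ‖ ≤ δ * r
  mem : ∀ γ ∈ truncAt p Γ δ, q + L γ (γ - p) + h γ ∈ F γ

/-- `ρ` is a modulus witnessing that `Λ` is a QDQ of `F` at `(p, q)` in the direction of `Γ`. -/
def IsQDQModulus {N n : ℕ}
    (F : EuclideanSpace ℝ (Fin N) → Set (EuclideanSpace ℝ (Fin n)))
    (p : EuclideanSpace ℝ (Fin N)) (q : EuclideanSpace ℝ (Fin n))
    (Λ : Set (EuclideanSpace ℝ (Fin N) →L[ℝ] EuclideanSpace ℝ (Fin n)))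
    (Γ : Set (EuclideanSpace ℝ (Fin N))) (ρ : ℝ → ℝ) : Prop :=
  IsModulus ρ ∧ ∀ δ : ℝ, 0 < δ → ∃ L h, IsQDQPair F p q Λ Γ δ (ρ δ) L h

/-- The compact set `Λ` of linear maps is a Quasi Differential Quotient (QDQ) of the set-valued
map `F` at `(p, q)` in the direction of the set `Γ`. -/
def IsQDQ {N n : ℕ}
    (F : EuclideanSpace ℝ (Fin N) → Set (EuclideanSpace ℝ (Fin n)))
    (p : EuclideanSpace ℝ (Fin N)) (q : EuclideanSpace ℝ (Fin n))
    (Λ : Set (EuclideanSpace ℝ (Fin N) →L[ℝ] EuclideanSpace ℝ (Fin n)))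
    (Γ : Set (EuclideanSpace ℝ (Fin N))) : Prop :=
  IsCompact Λ ∧ ∃ ρ : ℝ → ℝ, IsQDQModulus F p q Λ Γ ρ

/-! The target `w` is reached by solving `w = L γ (γ - p) + h γ`, where `L γ` stays near `Λ` and `h`
is small compared with `δ`. Compactness of `Λ` yields finitely many vectors `v i ∈ Γ` and continuous
nonnegative coefficients `c (L, y)` such that `L (∑ i, c (L, y) i • v i)` is within `‖y‖ / 4` of `y`
for all `L` near `Λ`. Brouwer's theorem is applied to pairs (coefficient vector, auxiliary `y`): `y`
absorbs the error, so approximate inverses suffice, and working with coefficients avoids any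
closedness of `Γ`. The case `w = 0` is not exceptional, which removes the puncture.

Brouwer's theorem comes from a volume argument. If `r` is `C¹`, sphere-valued and radial outside the
unit ball, then `id + t (r - id)` maps the ball bijectively to itself for small `t > 0`, so its
Jacobian determinant integrates to the volume of the ball. That determinant is polynomial in `t`, so
the identity persists at `t = 1`, where the determinant vanishes. -/

/-! ### Brouwer's fixed point theorem -/

section Brouwer

open MeasureTheory Metric

variable {E : Type*} [NormedAddCommGroup E] [InnerProductSpace ℝ E] [FiniteDimensional ℝ E]

/-- Lagrange interpolation for the polynomial `t ↦ det (1 + t A)`, with weights independent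
of `A`. -/
theorem exists_weights_det_one_add {V : Type*} [AddCommGroup V] [Module ℝ V] [FiniteDimensional ℝ V]
    (t : Fin (Module.finrank ℝ V + 1) → ℝ) (ht : Function.Injective t) :
    ∃ w : Fin (Module.finrank ℝ V + 1) → ℝ, ∑ i, w i = 1 ∧
      ∀ A : V →ₗ[ℝ] V, ∑ i, w i * LinearMap.det (1 + t i • A) = LinearMap.det (1 + A) := by
  -- The determinant has degree at most `finrank ℝ V` in `t`, so `finrank ℝ V + 1` nodes determine
  -- its value at `1`.
  refine ⟨fun i => (Lagrange.basis Finset.univ t i).eval 1, ?_, fun A => ?_⟩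
  · rw [← Polynomial.eval_finsetSum, Lagrange.sum_basis ht.injOn Finset.univ_nonempty,
      Polynomial.eval_one]
  · let b := Module.finBasis ℝ V
    let M := LinearMap.toMatrix b b A
    let P : Polynomial ℝ :=
      Matrix.det ((Polynomial.X : Polynomial ℝ) • M.map Polynomial.C +
        (1 : Matrix _ _ ℝ).map Polynomial.C)
    have hdeg : P.natDegree ≤ Module.finrank ℝ V := by
      simpa only [Fintype.card_fin] using Polynomial.natDegree_det_X_add_C_le M 1
    have heval : ∀ s : ℝ, P.eval s = LinearMap.det (1 + s • A) := by
      intro s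
      rw [← LinearMap.det_toMatrix b]
      simp only [P]
      rw [← Polynomial.coe_evalRingHom, RingHom.map_det]
      congr 1
      ext i j
      simp only [RingHom.mapMatrix_apply, Matrix.map_apply, Matrix.add_apply, Matrix.smul_apply,
        smul_eq_mul, map_add, Polynomial.coe_evalRingHom, Polynomial.eval_mul,
        Polynomial.eval_X, Polynomial.eval_C, map_smul, LinearMap.toMatrix_one, M]
      ring
    have hP : P = Lagrange.interpolate Finset.univ t fun i => P.eval (t i) := by
      apply Lagrange.eq_interpolate ht.injOn
      refine lt_of_le_of_lt Polynomial.degree_le_natDegree ?_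
      rw [Finset.card_univ, Fintype.card_fin]
      exact_mod_cast Nat.lt_succ_of_le hdeg
    have h1 := heval 1
    rw [one_smul] at h1
    rw [← h1]
    conv_rhs => rw [hP]
    rw [Lagrange.interpolate_apply, Polynomial.eval_finsetSum]
    refine Finset.sum_congr rfl fun i _ => ?_
    rw [Polynomial.eval_mul, Polynomial.eval_C, heval, mul_comm]

/-- Were the derivative onto, some `v` would be sent to `r x`; differentiating `‖r‖ ^ 2 = 1` along
`v` would give `2 * ‖r x‖ ^ 2 = 0`. -/
theorem det_fderiv_eq_zero_of_norm_eq_one {r : E → E} {x : E} (hr : DifferentiableAt ℝ r x)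
    (h1 : ∀ y, ‖r y‖ = 1) : (fderiv ℝ r x).det = 0 := by
  by_contra hdet
  have hs : Function.Surjective (fderiv ℝ r x) :=
    (LinearMap.equivOfDetNeZero (fderiv ℝ r x : E →ₗ[ℝ] E) hdet).surjective
  obtain ⟨v, hv⟩ := hs (r x)
  have hd := (hr.hasFDerivAt.inner ℝ hr.hasFDerivAt)
  have hc : (fun y => inner ℝ (r y) (r y)) = fun _ => (1 : ℝ) := by
    funext y
    rw [real_inner_self_eq_norm_sq, h1, one_pow]
  rw [hc] at hd
  have h0 := congrArg (fun T => T v) (hd.unique (hasFDerivAt_const (1 : ℝ) x))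
  simp [hv, h1] at h0

/-- There is no `C¹` map onto the unit sphere that coincides with the radial retraction outside
the unit ball. -/
theorem not_contDiff_of_norm_eq_one {r : E → E} (hr : ContDiff ℝ 1 r) (h1 : ∀ x, ‖r x‖ = 1)
    (h2 : ∀ x, 1 ≤ ‖x‖ → r x = ‖x‖⁻¹ • x) : False := by
  borelize E
  let μ : Measure E := Measure.addHaar
  let B : Set E := closedBall 0 1
  have hBc : IsCompact B := isCompact_closedBall 0 1
  let A : E → E →L[ℝ] E := fun x => fderiv ℝ r x - 1
  have hA : Continuous A := (hr.continuous_fderiv one_ne_zero).sub continuous_const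
  let g : E → E := fun x => r x - x
  have hg : ContDiff ℝ 1 g := hr.sub contDiff_id
  have hgA : ∀ x, HasFDerivAt g (A x) x := fun x =>
    (hr.differentiable one_ne_zero x).hasFDerivAt.sub (hasFDerivAt_id x)
  obtain ⟨K, hK⟩ : ∃ K, LipschitzOnWith K g (closedBall 0 3) :=
    hg.contDiffOn.exists_lipschitzOnWith one_ne_zero (convex_closedBall 0 3) (isCompact_closedBall 0 3)
  have hdetc : Continuous fun z : ℝ × E => (1 + z.1 • A z.2).det :=
    ContinuousLinearMap.continuous_det.comp
      (continuous_const.add (continuous_fst.smul (hA.comp continuous_snd)))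
  have hpos : ∀ᶠ t in 𝓝 (0 : ℝ), ∀ x ∈ B, 0 < (1 + t • A x).det := by
    apply hBc.eventually_forall_of_forall_eventually
    intro x _
    have h := hdetc.continuousAt (x := ((0 : ℝ), x))
    apply h.eventually (lt_mem_nhds _)
    simp [ContinuousLinearMap.det]
  have hK0 : ∀ᶠ t : ℝ in 𝓝 (0 : ℝ), t * (K : ℝ) < 1 := by
    have h : Continuous fun t : ℝ => t * (K : ℝ) := by fun_prop
    exact (h.tendsto 0).eventually (gt_mem_nhds (by simp))
  have hsmall : ∀ᶠ t in 𝓝 (0 : ℝ), t < 1 / 4 := gt_mem_nhds (by norm_num)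
  obtain ⟨t₀, ht₀, hball⟩ := Metric.eventually_nhds_iff_ball.1 (hpos.and (hK0.and hsmall))
  have hvol : ∀ t : ℝ, 0 < t → t < t₀ → ∫ x in B, (1 + t • A x).det ∂μ = μ.real B := by
    intro t ht htt
    obtain ⟨hp, hk, hs⟩ := hball t (by simpa [abs_of_pos ht] using htt)
    let f : E → E := fun x => x + t • g x
    have hfd : ∀ x ∈ B, HasFDerivWithinAt f (1 + t • A x) B x := fun x _ =>
      ((hasFDerivAt_id x).add ((hgA x).const_smul t)).hasFDerivWithinAt
    have hcontr : ∀ x ∈ closedBall (0 : E) 3, ∀ y ∈ closedBall (0 : E) 3,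
        ‖t • g x - t • g y‖ ≤ t * K * ‖x - y‖ := by
      intro x hx y hy
      rw [← smul_sub, norm_smul, Real.norm_of_nonneg ht.le, mul_assoc]
      exact mul_le_mul_of_nonneg_left (by simpa [dist_eq_norm] using hK.dist_le_mul x hx y hy) ht.le
    have hB3 : B ⊆ closedBall 0 3 := closedBall_subset_closedBall (by norm_num)
    have hinj : Set.InjOn f B := by
      intro x hx y hy hxy
      by_contra hne
      have h := hcontr x (hB3 hx) y (hB3 hy)
      have he : ‖t • g x - t • g y‖ = ‖x - y‖ := by
        rw [← norm_neg (x - y)]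
        congr 1
        rw [neg_sub, sub_eq_sub_iff_add_eq_add, add_comm]
        exact hxy
      have hxy' : 0 < ‖x - y‖ := norm_pos_iff.2 (sub_ne_zero.2 hne)
      nlinarith
    have himage : f '' B = B := by
      apply Set.Subset.antisymm
      · rintro _ ⟨x, hx, rfl⟩
        have hx' : ‖x‖ ≤ 1 := by simpa [B] using hx
        have he : f x = (1 - t) • x + t • r x := by simp only [f, g]; module
        have : ‖f x‖ ≤ 1 := by
          rw [he]
          refine (norm_add_le _ _).trans ?_
          rw [norm_smul, norm_smul, h1, Real.norm_of_nonneg ht.le,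
            Real.norm_of_nonneg (by linarith)]
          nlinarith
        simpa [B] using this
      · intro y hy
        have hy' : ‖y‖ ≤ 1 := by simpa [B] using hy
        -- Solving `f x = y` by contraction: `‖y‖ ≤ 1`, `‖g x‖ ≤ 4` and `t < 1 / 4` keep the
        -- iteration in the ball of radius `3`.
        have hmaps : Set.MapsTo (fun x => y - t • g x) (closedBall (0 : E) 3) (closedBall 0 3) := by
          intro x hx
          have hx' : ‖x‖ ≤ 3 := by simpa using hx
          have hgx : ‖g x‖ ≤ 4 := (norm_sub_le _ _).trans (by rw [h1]; linarith)
          have : ‖y - t • g x‖ ≤ 3 := by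
            refine (norm_sub_le _ _).trans ?_
            rw [norm_smul, Real.norm_of_nonneg ht.le]
            nlinarith [norm_nonneg (g x)]
          simpa using this
        have hcw : ContractingWith ⟨t * K, by positivity⟩ (hmaps.restrict _ _ _) := by
          refine ⟨by exact_mod_cast hk, LipschitzWith.of_dist_le_mul fun x x' => ?_⟩
          have := hcontr x' x'.2 x x.2
          rw [Subtype.dist_eq, Subtype.dist_eq, dist_eq_norm, dist_eq_norm, norm_sub_rev (x : E)]
          simpa only [Set.MapsTo.val_restrict_apply, sub_sub_sub_cancel_left] using! this
        obtain ⟨x, hx, hfx, -⟩ := hcw.exists_fixedPoint' isClosed_closedBall.isComplete hmaps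
          (mem_closedBall_self (by norm_num)) (edist_ne_top _ _)
        have hfx' : y - t • g x = x := hfx
        have hxy : f x = y := by
          simp only [f]
          nth_rewrite 1 [← hfx']
          abel
        refine ⟨x, ?_, hxy⟩
        -- Outside `B` the map is radial with `‖f x‖ = (1 - t) * ‖x‖ + t > 1`, contradicting `‖y‖ ≤
        -- 1`.
        by_contra hxB
        have hx1 : 1 < ‖x‖ := by simpa [B] using hxB
        have he : f x = ((1 - t) + t * ‖x‖⁻¹) • x := by
          simp only [f, g, h2 x hx1.le]; module
        have hn : ‖f x‖ = (1 - t) * ‖x‖ + t := by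
          have : 0 ≤ (1 - t) + t * ‖x‖⁻¹ := by
            have : 0 < t * ‖x‖⁻¹ := by positivity
            linarith
          rw [he, norm_smul, Real.norm_of_nonneg this, add_mul, mul_assoc,
            inv_mul_cancel₀ (by positivity), mul_one]
        rw [hxy] at hn
        nlinarith
    have hcv := integral_image_eq_integral_abs_det_fderiv_smul μ measurableSet_closedBall hfd hinj
      (fun _ => (1 : ℝ))
    rw [himage] at hcv
    rw [setIntegral_congr_fun (g := fun x => |(1 + t • A x).det| • (1 : ℝ))
      measurableSet_closedBall (fun x hx => by simp [abs_of_pos (hp x hx)]), ← hcv]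
    simp [Measure.real]
  -- Distinct nodes strictly between `0` and `t₀`; the shift by `2` excludes `t₀` itself.
  let τ : Fin (Module.finrank ℝ E + 1) → ℝ := fun i => t₀ / (i + 2)
  have hτ : Function.Injective τ := by
    intro i j hij
    simp only [τ] at hij
    rw [div_eq_div_iff (by positivity) (by positivity)] at hij
    have := mul_left_cancel₀ ht₀.ne' hij
    ext
    have h' : (j : ℝ) = i := by linarith
    exact_mod_cast h'.symm
  obtain ⟨w, hw, hdet⟩ := exists_weights_det_one_add τ hτ
  have hzero : ∀ x, ∑ i, w i * (1 + τ i • A x).det = 0 := by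
    intro x
    have h := hdet (A x : E →ₗ[ℝ] E)
    have h0 := det_fderiv_eq_zero_of_norm_eq_one (hr.differentiable one_ne_zero x) h1
    have he : (1 : E →ₗ[ℝ] E) + (A x : E →ₗ[ℝ] E) = (fderiv ℝ r x : E →ₗ[ℝ] E) := by
      ext v; simp [A]
    rw [he] at h
    exact h.trans h0
  have hint : ∀ i, IntegrableOn (fun x => w i * (1 + τ i • A x).det) B μ := fun i =>
    (continuous_const.mul (hdetc.comp (Continuous.prodMk_right (τ i)))).continuousOn.integrableOn_compact hBc
  have hsum : ∑ i, ∫ x in B, w i * (1 + τ i • A x).det ∂μ = 0 := by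
    rw [← integral_finsetSum _ fun i _ => hint i]
    simp [hzero]
  have hval : ∀ i, ∫ x in B, w i * (1 + τ i • A x).det ∂μ = w i * μ.real B := by
    intro i
    rw [integral_const_mul, hvol (τ i) (by simp only [τ]; positivity)]
    simp only [τ]
    rw [div_lt_iff₀ (by positivity)]
    nlinarith [(Nat.cast_nonneg i : (0 : ℝ) ≤ (i : ℕ))]
  simp only [hval, ← Finset.sum_mul, hw, one_mul] at hsum
  have hBpos : 0 < μ.real B :=
    ENNReal.toReal_pos (measure_closedBall_pos μ 0 one_pos).ne' hBc.measure_lt_top.ne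
  exact hBpos.ne' hsum

/-- A continuous map that is the identity outside the ball of radius `1 / 2` has a zero. -/
theorem exists_eq_zero_of_eq_self {f : E → E} (hf : Continuous f)
    (hid : ∀ x, 1 / 2 ≤ ‖x‖ → f x = x) : ∃ x, f x = 0 := by
  by_contra! hne
  let S : Set E := {x | 1 ≤ ‖x‖}
  let U : Set E := {x | 1 / 2 < ‖x‖}
  have hU : IsOpen U := isOpen_lt continuous_const continuous_norm
  have hSU : S ⊆ U := fun x hx => lt_of_lt_of_le (by norm_num) (show 1 ≤ ‖x‖ from hx)
  -- The error allowed at `x` is `‖f x‖`, with strict inequality, so `φ` cannot vanish.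
  obtain ⟨φ, hφ, hd, he, -⟩ := hf.exists_contDiff_approx_and_eqOn 1 hf.norm
    (fun x => norm_pos_iff.2 (hne x)) (S := S) (U := U) (isClosed_le continuous_const continuous_norm)
    (hU.mem_nhdsSet.2 hSU)
    (contDiffOn_id.congr fun x hx => hid x (le_of_lt hx))
  have hφ0 : ∀ x, φ x ≠ 0 := by
    intro x hx
    have := hd x
    rw [hx, dist_zero_left] at this
    exact lt_irrefl _ this
  refine not_contDiff_of_norm_eq_one (r := fun x => ‖φ x‖⁻¹ • φ x) ?_ ?_ ?_
  · have h : ContDiff ℝ 1 φ := hφ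
    exact ((h.norm ℝ hφ0).inv fun x => norm_ne_zero_iff.2 (hφ0 x)).smul h
  · intro x
    exact norm_smul_inv_norm (𝕜 := ℝ) (hφ0 x)
  · intro x hx
    have : φ x = x := (he hx).trans (hid x (by linarith))
    simp only [this]

/-- **Brouwer's fixed point theorem** for bounded maps of a Euclidean space. -/
theorem exists_fixedPoint_of_norm_le {F : E → E} (hF : Continuous F) {C : ℝ}
    (hC : ∀ x, ‖F x‖ ≤ C) : ∃ x, F x = x := by
  let R : ℝ := 4 * (|C| + 1)
  have hR : 0 < R := by positivity
  -- The cutoff is `1` for `‖x‖ ≤ 1 / 4` and `0` for `‖x‖ ≥ 1 / 2`. Since `‖F‖ ≤ R / 4`, every zero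
  -- of `f` lies where it is `1`.
  let f : E → E := fun x => x - (max 0 (min 1 (2 - 4 * ‖x‖)) * R⁻¹) • F (R • x)
  have hf : Continuous f := by
    have := hF.comp (continuous_const_smul R)
    fun_prop
  obtain ⟨x, hx⟩ := exists_eq_zero_of_eq_self hf fun x hx => by
    have : max 0 (min 1 (2 - 4 * ‖x‖)) = 0 := max_eq_left ((min_le_right _ _).trans (by linarith))
    simp [f, this]
  have hx' : x = (max 0 (min 1 (2 - 4 * ‖x‖)) * R⁻¹) • F (R • x) := sub_eq_zero.1 hx
  have hnx : ‖x‖ ≤ 1 / 4 := by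
    have h01 : max 0 (min 1 (2 - 4 * ‖x‖)) ≤ 1 := max_le zero_le_one (min_le_left _ _)
    have h00 : 0 ≤ max 0 (min 1 (2 - 4 * ‖x‖)) := le_max_left _ _
    have hFx : ‖F (R • x)‖ ≤ R * (1 / 4) :=
      (hC _).trans ((le_abs_self C).trans (by simp only [R]; linarith))
    rw [hx', norm_smul, norm_mul, Real.norm_of_nonneg h00, Real.norm_of_nonneg (by positivity)]
    calc _ ≤ 1 * R⁻¹ * (R * (1 / 4)) := by gcongr
      _ = 1 / 4 := by field_simp
  have hone : max 0 (min 1 (2 - 4 * ‖x‖)) = 1 := by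
    rw [min_eq_left (by linarith), max_eq_right zero_le_one]
  rw [hone, one_mul] at hx'
  refine ⟨R • x, ?_⟩
  conv_rhs => rw [hx']
  rw [smul_smul, mul_inv_cancel₀ hR.ne', one_smul]

/-- **Brouwer's fixed point theorem** for bounded maps of a finite-dimensional normed space. -/
theorem exists_fixedPoint_of_norm_le' {V : Type*} [NormedAddCommGroup V] [NormedSpace ℝ V]
    [FiniteDimensional ℝ V] {F : V → V} (hF : Continuous F) {C : ℝ} (hC : ∀ x, ‖F x‖ ≤ C) :
    ∃ x, F x = x := by
  let e : V ≃L[ℝ] EuclideanSpace ℝ (Fin (Module.finrank ℝ V)) := toEuclidean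
  let T : V →L[ℝ] EuclideanSpace ℝ (Fin (Module.finrank ℝ V)) := e
  obtain ⟨x, hx⟩ := exists_fixedPoint_of_norm_le (F := fun x => e (F (e.symm x)))
    (by fun_prop) (C := ‖T‖ * C) fun x => T.le_opNorm_of_le (hC _)
  exact ⟨e.symm x, by rw [← e.symm_apply_apply (F (e.symm x)), hx]⟩

end Brouwer

/-! ### Approximate right inverses in the cone and the covering argument -/

section OpenMapping

variable {N n : ℕ}

local notation "𝔼" d => EuclideanSpace ℝ (Fin d)

/-- The positive (`b = true`) or negative (`b = false`) part of the `i`-th coordinate. -/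
noncomputable def signedPart (k : Fin n × Bool) (y : 𝔼 n) : ℝ :=
  max 0 (if k.2 then y k.1 else -y k.1)

theorem continuous_signedPart (k : Fin n × Bool) : Continuous (signedPart k) := by
  obtain ⟨i, b⟩ := k
  cases b <;> simp +unfoldPartialApp only [signedPart, if_true, Bool.false_eq_true, if_false] <;>
    fun_prop

theorem signedPart_nonneg (k : Fin n × Bool) (y : 𝔼 n) : 0 ≤ signedPart k y := le_max_left _ _

theorem signedPart_le_norm (k : Fin n × Bool) (y : 𝔼 n) : signedPart k y ≤ ‖y‖ := by
  have h := abs_le.1 (PiLp.norm_apply_le y k.1)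
  refine max_le (norm_nonneg _) ?_
  split_ifs <;> linarith

/-- A cone admits only nonnegative combinations, hence the use of both signs of each basis vector.
-/
theorem sum_signedPart_smul_single (y : 𝔼 n) :
    ∑ k : Fin n × Bool, signedPart k y •
      ((if k.2 then 1 else -1 : ℝ) • EuclideanSpace.single k.1 (1 : ℝ)) = y := by
  rw [Fintype.sum_prod_type]
  have h : ∀ t : ℝ, max 0 t - max 0 (-t) = t := fun t => by
    rcases le_total 0 t with ht | ht
    · rw [max_eq_right ht, max_eq_left (by linarith), sub_zero]
    · rw [max_eq_left ht, max_eq_right (by linarith)]; ring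
  ext j
  simp [signedPart, ← sub_eq_add_neg, Pi.single_apply, h]

theorem PointedCone.sum_smul_mem {V ι : Type*} [AddCommGroup V] [Module ℝ V] [Fintype ι]
    (Γ : PointedCone ℝ V) {v : ι → V} (hv : ∀ i, v i ∈ Γ) {c : ι → ℝ} (hc : ∀ i, 0 ≤ c i) :
    ∑ i, c i • v i ∈ Γ :=
  Γ.sum_mem fun i _ => Γ.smul_mem (hc i) (hv i)

theorem norm_sum_smul_le {V ι : Type*} [NormedAddCommGroup V] [NormedSpace ℝ V] [Fintype ι]
    (v : ι → V) {c : ι → ℝ} {M : ℝ} (hc : ∀ i, 0 ≤ c i) (hM : ∀ i, c i ≤ M) :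
    ‖∑ i, c i • v i‖ ≤ M * ∑ i, ‖v i‖ := by
  rw [Finset.mul_sum]
  refine norm_sum_le_of_le _ fun i _ => ?_
  rw [norm_smul, Real.norm_of_nonneg (hc i)]
  exact mul_le_mul_of_nonneg_right (hM i) (norm_nonneg _)

/-- A linear map that is onto on a convex cone has a right inverse with values in the cone, which
is an approximate right inverse of every nearby map. -/
theorem exists_local_approx_rightInverse (Γ : PointedCone ℝ (𝔼 N)) {L₀ : (𝔼 N) →L[ℝ] (𝔼 n)}
    (hL₀ : L₀ '' (Γ : Set (𝔼 N)) = Set.univ) :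
    ∃ (v : Fin n × Bool → 𝔼 N) (η : ℝ), (∀ k, v k ∈ Γ) ∧ 0 < η ∧
      ∀ L : (𝔼 N) →L[ℝ] (𝔼 n), ‖L - L₀‖ ≤ η → ∀ y : 𝔼 n,
        ‖L (∑ k, signedPart k y • v k) - y‖ ≤ ‖y‖ / 4 := by
  have hex : ∀ z : 𝔼 n, ∃ x ∈ Γ, L₀ x = z := fun z => by
    have : z ∈ L₀ '' (Γ : Set (𝔼 N)) := hL₀ ▸ Set.mem_univ z
    exact this
  choose s hsΓ hs using hex
  let v : Fin n × Bool → 𝔼 N := fun k =>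
    s ((if k.2 then 1 else -1 : ℝ) • EuclideanSpace.single k.1 (1 : ℝ))
  let C : ℝ := 1 + ∑ k, ‖v k‖
  have hC : 0 < C := by positivity
  refine ⟨v, 1 / (4 * C), fun k => hsΓ _, by positivity, fun L hL y => ?_⟩
  have h0 : L₀ (∑ k, signedPart k y • v k) = y := by
    simp only [map_sum, map_smul, v, hs]
    exact sum_signedPart_smul_single y
  have hle : ‖∑ k, signedPart k y • v k‖ ≤ C * ‖y‖ := by
    refine (norm_sum_smul_le v (fun k => signedPart_nonneg k y)
      (fun k => signedPart_le_norm k y)).trans ?_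
    rw [mul_comm]
    exact mul_le_mul_of_nonneg_right (by simp [C]) (norm_nonneg _)
  have he : L (∑ k, signedPart k y • v k) - y = (L - L₀) (∑ k, signedPart k y • v k) := by
    rw [sub_apply, h0]
  rw [he]
  calc _ ≤ 1 / (4 * C) * (C * ‖y‖) := (L - L₀).le_of_opNorm_le_of_le hL hle
    _ = ‖y‖ / 4 := by field_simp

/-- For a compact set of maps that are onto on a convex cone, approximate right inverses can be
chosen continuously near the set, with values in a finitely generated subcone. -/
theorem exists_approx_rightInverse (Γ : PointedCone ℝ (𝔼 N)) {Λ : Set ((𝔼 N) →L[ℝ] (𝔼 n))}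
    (hΛ : IsCompact Λ) (hsurj : ∀ L ∈ Λ, L '' (Γ : Set (𝔼 N)) = Set.univ) :
    ∃ (ι : Type) (_ : Fintype ι) (v : ι → 𝔼 N) (c : ((𝔼 N) →L[ℝ] (𝔼 n)) × (𝔼 n) → ι → ℝ) (ε : ℝ),
      (∀ i, v i ∈ Γ) ∧ 0 < ε ∧ ContinuousOn c (Metric.cthickening ε Λ ×ˢ Set.univ) ∧
      ∀ L ∈ Metric.cthickening ε Λ, ∀ y : 𝔼 n,
        (∀ i, 0 ≤ c (L, y) i) ∧ (∀ i, c (L, y) i ≤ ‖y‖) ∧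
        ‖L (∑ i, c (L, y) i • v i) - y‖ ≤ ‖y‖ / 4 := by
  choose v η hvΓ hη happ using fun L : Λ => exists_local_approx_rightInverse Γ (hsurj L L.2)
  obtain ⟨t, ht⟩ := hΛ.elim_finite_subcover (fun L : Λ => Metric.ball (L : _ →L[ℝ] _) (η L))
    (fun _ => Metric.isOpen_ball)
    (fun L hL => Set.mem_iUnion.2 ⟨⟨L, hL⟩, Metric.mem_ball_self (hη _)⟩)
  obtain ⟨m, f, hf⟩ : ∃ (m : ℕ) (f : Fin m → Λ), Set.range f = t :=
    ⟨t.card, fun i => t.equivFin.symm i, by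
      ext x
      simp only [Set.mem_range, Finset.mem_coe]
      exact ⟨fun ⟨i, hi⟩ => hi ▸ (t.equivFin.symm i).2,
        fun hx => ⟨t.equivFin ⟨x, hx⟩, by simp⟩⟩⟩
  -- Tent functions on the covering balls; normalised where their sum is positive, they form a
  -- partition of unity that glues the local inverses.
  let ψ : Fin m → ((𝔼 N) →L[ℝ] (𝔼 n)) → ℝ := fun j L => max 0 (η (f j) - ‖L - f j‖)
  have hψc : ∀ j, Continuous (ψ j) := fun j => by fun_prop
  have hψ0 : ∀ j L, 0 ≤ ψ j L := fun j L => le_max_left _ _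
  let U : Set ((𝔼 N) →L[ℝ] (𝔼 n)) := {L | 0 < ∑ j, ψ j L}
  have hU : IsOpen U :=
    isOpen_lt continuous_const (continuous_finsetSum _ fun j _ => hψc j)
  have hΛU : Λ ⊆ U := by
    intro L hL
    obtain ⟨x, hx, hLx⟩ := Set.mem_iUnion₂.1 (ht hL)
    obtain ⟨j, rfl⟩ : x ∈ Set.range f := hf ▸ hx
    have : 0 < ψ j L := lt_max_of_lt_right (sub_pos.2 (by simpa [dist_eq_norm] using hLx))
    exact this.trans_le (Finset.single_le_sum (fun j _ => hψ0 j L) (Finset.mem_univ j))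
  obtain ⟨ε, hε, hεU⟩ := hΛ.exists_cthickening_subset_open hU hΛU
  let φ : Fin m → ((𝔼 N) →L[ℝ] (𝔼 n)) → ℝ := fun j L => ψ j L / ∑ j, ψ j L
  have hφ0 : ∀ j L, 0 ≤ φ j L := fun j L =>
    div_nonneg (hψ0 j L) (Finset.sum_nonneg fun j _ => hψ0 j L)
  have hφ1 : ∀ L ∈ U, ∑ j, φ j L = 1 := fun L hL => by
    simp only [φ, ← Finset.sum_div]
    exact div_self (ne_of_gt hL)
  refine ⟨Fin m × (Fin n × Bool), inferInstance, fun i => v (f i.1) i.2,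
    fun z i => φ i.1 z.1 * signedPart i.2 z.2, ε, fun i => hvΓ _ _, hε, ?_, fun L hL y =>
      ⟨fun i => mul_nonneg (hφ0 _ _) (signedPart_nonneg _ _), fun i => ?_, ?_⟩⟩
  · refine continuousOn_pi.2 fun i => ContinuousOn.mul (ContinuousOn.div ?_ ?_ ?_) ?_
    · exact ((hψc i.1).comp continuous_fst).continuousOn
    · exact (continuous_finsetSum _ fun j _ => (hψc j).comp continuous_fst).continuousOn
    · exact fun z hz => ne_of_gt (hεU hz.1)
    · exact ((continuous_signedPart i.2).comp continuous_snd).continuousOn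
  · have hle : φ i.1 L ≤ 1 := by
      rw [← hφ1 L (hεU hL)]
      exact Finset.single_le_sum (f := fun j => φ j L) (fun j _ => hφ0 j L) (Finset.mem_univ _)
    calc _ ≤ 1 * ‖y‖ := mul_le_mul hle (signedPart_le_norm _ _) (signedPart_nonneg _ _) zero_le_one
      _ = ‖y‖ := one_mul _
  · have he : L (∑ i : Fin m × (Fin n × Bool),
          (φ i.1 L * signedPart i.2 y) • v (f i.1) i.2) - y =
        ∑ j, φ j L • (L (∑ k, signedPart k y • v (f j) k) - y) := by
      simp only [smul_sub, Finset.sum_sub_distrib, ← Finset.sum_smul, hφ1 L (hεU hL), one_smul,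
        ← map_smul, ← map_sum, Finset.smul_sum, smul_smul, Fintype.sum_prod_type]
    rw [he]
    calc _ ≤ ∑ j, φ j L * (‖y‖ / 4) := norm_sum_le_of_le _ fun j _ => ?_
      _ = ‖y‖ / 4 := by rw [← Finset.sum_mul, hφ1 L (hεU hL), one_mul]
    rw [norm_smul, Real.norm_of_nonneg (hφ0 j L)]
    rcases (hψ0 j L).eq_or_lt with h0 | hpos
    · simp [φ, ← h0]
    · refine mul_le_mul_of_nonneg_left (happ (f j) L ?_ y) (hφ0 j L)
      rcases lt_max_iff.1 hpos with h | h
      · exact absurd h (lt_irrefl _)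
      · linarith

/-- The radial retraction onto the closed ball of radius `R`. -/
noncomputable def radialRetraction {V : Type*} [NormedAddCommGroup V] [NormedSpace ℝ V] (R : ℝ)
    (y : V) : V :=
  (R / max R ‖y‖) • y

section RadialRetraction

variable {V : Type*} [NormedAddCommGroup V] [NormedSpace ℝ V] {R : ℝ}

theorem continuous_radialRetraction (hR : 0 < R) :
    Continuous (radialRetraction R : V → V) :=
  (continuous_const.div (continuous_const.max continuous_norm)
    fun _ => (lt_max_of_lt_left hR).ne').smul continuous_id

theorem norm_radialRetraction_le (hR : 0 < R) (y : V) : ‖radialRetraction R y‖ ≤ R := by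
  have h : 0 < max R ‖y‖ := lt_max_of_lt_left hR
  rw [radialRetraction, norm_smul, Real.norm_of_nonneg (by positivity), div_mul_eq_mul_div,
    div_le_iff₀ h]
  exact mul_le_mul_of_nonneg_left (le_max_right _ _) hR.le

theorem radialRetraction_eq_self (hR : 0 < R) {y : V} (hy : ‖y‖ ≤ R) :
    radialRetraction R y = y := by
  rw [radialRetraction, max_eq_left hy, div_self hR.ne', one_smul]

end RadialRetraction

/-- The maps `γ ↦ L γ (γ - p) + h γ` attached to QDQ pairs cover a ball of radius proportional
to `δ`. -/
theorem exists_isQDQPair_cover (Γ : PointedCone ℝ (𝔼 N)) {Λ : Set ((𝔼 N) →L[ℝ] (𝔼 n))}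
    (hΛ : IsCompact Λ) (hsurj : ∀ L ∈ Λ, L '' (Γ : Set (𝔼 N)) = Set.univ) :
    ∃ β r₀ : ℝ, 0 < β ∧ 0 < r₀ ∧ ∀ (F : (𝔼 N) → Set (𝔼 n)) (p : 𝔼 N) (q : 𝔼 n) (δ r : ℝ),
      0 < δ → r ≤ r₀ → ∀ L h, IsQDQPair F p q Λ Γ δ r L h → ∀ w : 𝔼 n, ‖w‖ * β ≤ δ →
        ∃ γ ∈ truncAt p (Γ : Set (𝔼 N)) δ, w = L γ (γ - p) + h γ := by
  obtain ⟨ι, _, v, c, ε, hv, hε, hcc, hc⟩ := exists_approx_rightInverse Γ hΛ hsurj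
  let C : ℝ := 1 + ∑ i, ‖v i‖
  have hC : 0 < C := by positivity
  -- With `R = δ / C`, coefficients up to `R` give vectors of norm at most `δ`. These constants make
  -- `‖w‖`, the inversion error and `‖h‖` each at most `R / 4`, and keep `L γ` within `ε` of `Λ`.
  refine ⟨4 * C, min ε (1 / (4 * C)), by positivity, by positivity, ?_⟩
  intro F p q δ r hδ hr L h hLh w hw
  let R : ℝ := δ / C
  have hR : 0 < R := by positivity
  have hwR : ‖w‖ ≤ R / 4 := by
    simp only [R]
    rw [div_div, le_div_iff₀ (by positivity)]
    linarith
  let clamp : ℝ → ℝ := fun s => max 0 (min R s)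
  have hclampc : Continuous clamp := by fun_prop
  -- Clamping sends every coefficient vector into the domain of `L` and `h`.
  let g : (ι → ℝ) → 𝔼 N := fun a => p + ∑ i, clamp (a i) • v i
  have hgc : Continuous g := by fun_prop
  have hg : ∀ a, g a ∈ truncAt p (Γ : Set (𝔼 N)) δ := by
    intro a
    have h0 : ∀ i, 0 ≤ clamp (a i) := fun i => le_max_left _ _
    refine ⟨_, ⟨Γ.sum_smul_mem hv h0, ?_⟩, rfl⟩
    rw [mem_closedBall_zero_iff]
    refine (norm_sum_smul_le v h0 fun i => max_le hR.le (min_le_left _ _)).trans ?_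
    calc R * ∑ i, ‖v i‖ ≤ R * C := mul_le_mul_of_nonneg_left (by simp [C]) hR.le
      _ = δ := div_mul_cancel₀ _ hC.ne'
  have hLg : Continuous fun a => L (g a) := hLh.continuousOn_L.comp_continuous hgc hg
  have hhg : Continuous fun a => h (g a) := hLh.continuousOn_h.comp_continuous hgc hg
  have hmem : ∀ a, L (g a) ∈ Metric.cthickening ε Λ := by
    intro a
    obtain ⟨L', hL', hd⟩ := hLh.near _ (hg a)
    exact Metric.mem_cthickening_of_dist_le _ L' _ _ hL'
      (by rw [dist_eq_norm]; exact hd.trans (hr.trans (min_le_left _ _)))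
  have hsmall : ∀ a, ‖h (g a)‖ ≤ R / 4 := fun a =>
    (hLh.small _ (hg a)).trans <| by
      calc δ * r ≤ δ * (1 / (4 * C)) :=
            mul_le_mul_of_nonneg_left (hr.trans (min_le_right _ _)) hδ.le
        _ = R / 4 := by simp only [R]; field_simp
  let Y : (𝔼 n) → 𝔼 n := radialRetraction R
  have hY : Continuous Y := continuous_radialRetraction hR
  have hYR : ∀ y, ‖Y y‖ ≤ R := norm_radialRetraction_le hR
  let A : (ι → ℝ) × (𝔼 n) → ι → ℝ := fun z => c (L (g z.1), Y z.2)
  have hA : Continuous A :=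
    hcc.comp_continuous ((hLg.comp continuous_fst).prodMk (hY.comp continuous_snd))
      fun z => ⟨hmem _, Set.mem_univ _⟩
  -- At a fixed point `(a, y)` the bounds make the clamp and `Y` inactive: then `g a - p = ∑ i, a i
  -- • v i`, and cancelling `y` in the second component leaves the desired equation.
  let Φ : (ι → ℝ) × (𝔼 n) → (ι → ℝ) × (𝔼 n) := fun z =>
    (A z, Y z.2 + w - L (g z.1) (∑ i, A z i • v i) - h (g z.1))
  have hAv : Continuous fun z => ∑ i, A z i • v i :=
    continuous_finsetSum _ fun i _ => ((continuous_apply i).comp hA).smul continuous_const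
  have hΦ : Continuous Φ := hA.prodMk <|
    (((hY.comp continuous_snd).add continuous_const).sub
      ((hLg.comp continuous_fst).clm_apply hAv)).sub (hhg.comp continuous_fst)
  have hA0 : ∀ z i, 0 ≤ A z i := fun z i => (hc _ (hmem z.1) (Y z.2)).1 i
  have hAR : ∀ z i, A z i ≤ R := fun z i => ((hc _ (hmem z.1) (Y z.2)).2.1 i).trans (hYR _)
  have hΦ2 : ∀ z, ‖(Φ z).2‖ ≤ R := by
    intro z
    have h1 := (hc _ (hmem z.1) (Y z.2)).2.2
    have he : (Φ z).2 = w - (L (g z.1) (∑ i, A z i • v i) - Y z.2) - h (g z.1) := by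
      simp only [Φ]; abel
    rw [he]
    have h2 := norm_sub_le (w - (L (g z.1) (∑ i, A z i • v i) - Y z.2)) (h (g z.1))
    have h3 := norm_sub_le w (L (g z.1) (∑ i, A z i • v i) - Y z.2)
    have h4 := hsmall z.1
    have h5 := hYR z.2
    simp only [A] at h1 h2 h3 ⊢
    linarith
  have hΦ1 : ∀ z, ‖(Φ z).1‖ ≤ R := fun z => (pi_norm_le_iff_of_nonneg hR.le).2 fun i => by
    rw [Real.norm_of_nonneg (hA0 z i)]
    exact hAR z i
  obtain ⟨z, hz⟩ := exists_fixedPoint_of_norm_le' hΦ fun z => max_le (hΦ1 z) (hΦ2 z)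
  have hz1 : A z = z.1 := congrArg Prod.fst hz
  have hz2 : Y z.2 + w - L (g z.1) (∑ i, A z i • v i) - h (g z.1) = z.2 := congrArg Prod.snd hz
  have hYz : Y z.2 = z.2 := radialRetraction_eq_self hR (by rw [← hz]; exact hΦ2 z)
  have hgz : g z.1 - p = ∑ i, A z i • v i := by
    simp only [g, add_sub_cancel_left]
    refine Finset.sum_congr rfl fun i _ => ?_
    rw [← hz1]
    simp only [clamp, min_eq_right (hAR z i), max_eq_right (hA0 z i)]
  refine ⟨g z.1, hg _, ?_⟩
  rw [hgz]
  rw [hYz] at hz2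
  rw [← sub_eq_zero, ← sub_eq_zero.2 hz2]
  abel

theorem IsModulus.exists_le {ρ : ℝ → ℝ} (hρ : IsModulus ρ) {r : ℝ} (hr : 0 < r) :
    ∃ δ₀ : ℝ, 0 < δ₀ ∧ ∀ δ : ℝ, 0 < δ → δ ≤ δ₀ → ρ δ ≤ r := by
  obtain ⟨u, hu, hsub⟩ := mem_nhdsGT_iff_exists_Ioc_subset.1
    (hρ.tendsto.eventually (ge_mem_nhds hr))
  exact ⟨u, hu, fun δ h0 h1 => hsub ⟨h0, h1⟩⟩

end OpenMapping

/-! ### The open mapping theorem -/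

theorem mainTheorem5 {N n : ℕ} (hN : 0 < N) (hn : 0 < n)
    (Γ : PointedCone ℝ (EuclideanSpace ℝ (Fin N)))
    (F : EuclideanSpace ℝ (Fin N) → Set (EuclideanSpace ℝ (Fin n)))
    (p : EuclideanSpace ℝ (Fin N)) (q : EuclideanSpace ℝ (Fin n))
    (Λ : Set (EuclideanSpace ℝ (Fin N) →L[ℝ] EuclideanSpace ℝ (Fin n)))
    (hΛ : IsQDQ F p q Λ (Γ : Set (EuclideanSpace ℝ (Fin N))))
    (hsurj : ∀ L ∈ Λ, L '' (Γ : Set (EuclideanSpace ℝ (Fin N))) = Set.univ) :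
    -- (i) the punctured open-mapping inclusion
    (∃ α : ℝ, 0 < α ∧ ∃ β : ℝ, 0 < β ∧ ∀ a : ℝ, 0 < a → a ≤ α →
      (fun w => q + w) '' (Metric.closedBall (0 : EuclideanSpace ℝ (Fin n)) a \ {0}) ⊆
        setImage F (truncAt p Γ (a * β))) ∧
    -- (ii) every QDQ approximation of small radius hits `q` exactly
    (∀ ρ : ℝ → ℝ, IsQDQModulus F p q Λ Γ ρ →
      ∃ δ₀ : ℝ, 0 < δ₀ ∧ ∀ δ : ℝ, 0 < δ → δ ≤ δ₀ →
        ∀ L h, IsQDQPair F p q Λ Γ δ (ρ δ) L h →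
          ∃ γ ∈ truncAt p Γ δ, q = q + L γ (γ - p) + h γ ∧ q ∈ F γ) ∧
    -- the open-mapping inclusion, for any constants as in (i), after reducing `α`
    (∀ α : ℝ, 0 < α → ∀ β : ℝ, 0 < β →
      (∀ a : ℝ, 0 < a → a ≤ α →
        (fun w => q + w) '' (Metric.closedBall (0 : EuclideanSpace ℝ (Fin n)) a \ {0}) ⊆
          setImage F (truncAt p Γ (a * β))) →
      ∃ α' : ℝ, 0 < α' ∧ α' ≤ α ∧ ∀ a : ℝ, 0 < a → a ≤ α' →
        (fun w => q + w) '' Metric.closedBall (0 : EuclideanSpace ℝ (Fin n)) a ⊆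
          setImage F (truncAt p Γ (a * β))) := by


  obtain ⟨hΛc, ρ₀, hρ₀⟩ := hΛ
  obtain ⟨β₀, r₀, hβ₀, hr₀, hcover⟩ := exists_isQDQPair_cover Γ hΛc hsurj
  have hii : ∀ ρ : ℝ → ℝ, IsQDQModulus F p q Λ Γ ρ →
      ∃ δ₀ : ℝ, 0 < δ₀ ∧ ∀ δ : ℝ, 0 < δ → δ ≤ δ₀ →
        ∀ L h, IsQDQPair F p q Λ Γ δ (ρ δ) L h →
          ∃ γ ∈ truncAt p Γ δ, q = q + L γ (γ - p) + h γ ∧ q ∈ F γ := by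
    intro ρ hρ
    obtain ⟨δ₀, hδ₀, hle⟩ := hρ.1.exists_le hr₀
    refine ⟨δ₀, hδ₀, fun δ h0 h1 L h hLh => ?_⟩
    -- The target `w = 0` meets the size condition `‖w‖ * β₀ ≤ δ` for every `δ > 0`.
    obtain ⟨γ, hγ, hw⟩ := hcover F p q δ (ρ δ) h0 (hle δ h0 h1) L h hLh 0 (by simp [h0.le])
    have hq : q = q + L γ (γ - p) + h γ := by rw [add_assoc, ← hw, add_zero]
    exact ⟨γ, hγ, hq, by simpa only [← hq] using hLh.mem γ hγ⟩
  refine ⟨?_, hii, ?_⟩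
  · obtain ⟨δ₀, hδ₀, hle⟩ := hρ₀.1.exists_le hr₀
    refine ⟨δ₀ / β₀, by positivity, β₀, hβ₀, fun a ha haα => ?_⟩
    rintro _ ⟨w, ⟨hw, -⟩, rfl⟩
    have hδ : 0 < a * β₀ := by positivity
    obtain ⟨L, h, hLh⟩ := hρ₀.2 (a * β₀) hδ
    obtain ⟨γ, hγ, he⟩ := hcover F p q _ _ hδ (hle _ hδ ((le_div_iff₀ hβ₀).1 haα)) L h hLh w
      (mul_le_mul_of_nonneg_right (mem_closedBall_zero_iff.1 hw) hβ₀.le)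
    refine Set.mem_iUnion₂.2 ⟨γ, hγ, ?_⟩
    have hmem := hLh.mem γ hγ
    rwa [add_assoc, ← he] at hmem
  · intro α hα β hβ hi
    obtain ⟨δ₀, hδ₀, hhit⟩ := hii ρ₀ hρ₀
    refine ⟨min α (δ₀ / β), by positivity, min_le_left _ _, fun a ha haα => ?_⟩
    rintro _ ⟨w, hw, rfl⟩
    -- Only the centre is new; there (ii) applies with `δ = a * β`, for whatever `β` was given.
    rcases eq_or_ne w 0 with rfl | hw0
    · have hδ : 0 < a * β := by positivity
      obtain ⟨L, h, hLh⟩ := hρ₀.2 (a * β) hδ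
      obtain ⟨γ, hγ, -, hq⟩ := hhit _ hδ ((le_div_iff₀ hβ).1 (haα.trans (min_le_right _ _))) L h hLh
      exact Set.mem_iUnion₂.2 ⟨γ, hγ, by simpa using hq⟩
    · exact hi a ha (haα.trans (min_le_left _ _)) ⟨w, ⟨hw, hw0⟩, rfl⟩
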